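/- Let $G$ be a weighted directed graph on $n$ vertices with nonnegative weight matrix $A=[a_{ij}]$, in which there is an edge from $j$ to $i$ exactly when $a_{ij}>0$ (agent $i$ receives the state of agent $j$), and let $L=D-A$ be its Laplacian, where $D=\mathrm{diag}\big(\sum_j a_{1j},\dots,\sum_j a_{nj}\big)$. Consider the switched multi-agent system composed of the continuous-time subsystem $\dot x(t)=-Lx(t)$ and the discrete-time subsystem $x(t+1)=(I_n-hL)x(t)$, with state $x(t)\in\mathbb R^n$. A switching law is a set of instants $s\ge 0$, any two of which are at least one unit of time apart, at which a discrete-time step starts: the discrete-time subsystem is active on the corresponding intervals $[s,s+1)$ and takes $x(s)$ to $x(s+1)=(I_n-hL)x(s)$, and the continuous-time subsystem is active at all other times $t\ge 0$. The state is considered at all $t\ge 0$ outside the open intervals $(s,s+1)$, and limits as $t\to\infty$ are taken along these times. Suppose that $G$ has a directed spanning tree, that is, there are a set $T$ of edges of $G$ and a vertex (the root) from which there is a unique directed path (with distinct edges) in $T$ to every other vertex. Let $$0<h<\min_{\lambda}\frac{2\,\mathrm{Re}(\lambda)}{|\lambda|^2},$$ where the minimum is over the nonzero complex eigenvalues $\lambda$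 of $L$ (if there are none, only $h>0$ is required). Then the switched system reaches consensus under arbitrary switching: for every switching law and every initial state $x(0)\in\mathbb R^n$ a trajectory exists and there is $x^*\in\mathbb R$ such that $\lim_{t\to\infty}|x_i(t)-x^*|=0$ for all $i$ along every trajectory. Moreover, there is exactly one $w\in\mathbb R^n$ with $w^TL=0$ and $w^T\mathbf 1=1$, and $x^*=w^Tx(0)$, i.e. $x(t)\to\mathbf 1w^Tx(0)$, for every switching law. -/

import Mathlib

open Filter Topology

/-- A weighted directed graph on `n` vertices, given by its nonnegative weight matrix `[a_ij]`. -/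
structure WeightedDigraph (n : ℕ) where
  weight : Matrix (Fin n) (Fin n) ℝ
  weight_nonneg : ∀ i j, 0 ≤ weight i j

/-- `p` lists the successive vertices of a directed path from `u` to `v` for the edge relation `E`:
consecutive vertices are joined by edges, and the edges used are distinct. -/
def IsDirectedPath {V : Type*} (E : V → V → Prop) (u v : V) (p : List V) : Prop :=
  p.head? = some u ∧ p.getLast? = some v ∧ p.IsChain E ∧ (p.zip p.tail).Nodup

/-- A directed tree: some root has a unique directed path to every other vertex. -/
def IsDirectedTree {V : Type*} (E : V → V → Prop) : Prop :=
  ∃ r : V, ∀ v : V, v ≠ r → ∃! p : List V, IsDirectedPath E r v p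

namespace WeightedDigraph

variable {n : ℕ}

/-- There is an edge from `j` to `i` when `a_ij > 0`, that is, when agent `i` receives the state
of agent `j`. -/
def Edge (G : WeightedDigraph n) (j i : Fin n) : Prop := 0 < G.weight i j

/-- The graph contains a directed tree made of all its vertices and some of its edges. -/
def HasDirectedSpanningTree (G : WeightedDigraph n) : Prop :=
  ∃ T : Fin n → Fin n → Prop, (∀ u v, T u v → G.Edge u v) ∧ IsDirectedTree T

/-- The Laplacian `D - A`, where `D` is the diagonal matrix of the row sums of `A`. -/
def laplacian (G : WeightedDigraph n) : Matrix (Fin n) (Fin n) ℝ :=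
  Matrix.diagonal (fun i => ∑ j, G.weight i j) - G.weight

/-- `μ` is a (complex) eigenvalue of the Laplacian. -/
def IsLaplacianEigenvalue (G : WeightedDigraph n) (μ : ℂ) : Prop :=
  Module.End.HasEigenvalue (Matrix.toLin' (G.laplacian.map Complex.ofReal)) μ

end WeightedDigraph

/-- A switching law between the continuous-time and the discrete-time subsystem on `[0, ∞)`.
It is given by the set of instants at which a discrete-time step starts; each step occupies one
unit of time, so that distinct steps start at least one unit apart. The discrete-time subsystem is
active on the intervals `[s, s + 1)` with `s ∈ steps`, the continuous-time one at all other
times. -/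
structure SwitchingLaw where
  steps : Set ℝ
  steps_nonneg : ∀ s ∈ steps, 0 ≤ s
  steps_separated : ∀ s ∈ steps, ∀ s' ∈ steps, s < s' → s + 1 ≤ s'

namespace SwitchingLaw

/-- The times at which the continuous-time subsystem is active. -/
def ctTimes (S : SwitchingLaw) : Set ℝ :=
  {t | 0 ≤ t ∧ ∀ s ∈ S.steps, t ∉ Set.Ico s (s + 1)}

/-- The times at which the state is defined: all of `[0, ∞)` except the interiors of the
discrete-time steps. -/
def timeDomain (S : SwitchingLaw) : Set ℝ :=
  {t | 0 ≤ t ∧ ∀ s ∈ S.steps, t ∉ Set.Ioo s (s + 1)}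

/-- The filter `t → ∞` along the times at which the state is defined. -/
def toInfinity (S : SwitchingLaw) : Filter ℝ := atTop ⊓ 𝓟 S.timeDomain

end SwitchingLaw

/-- `x` is a trajectory of the switched system with Laplacian `L`, sampling period `h` and
switching law `S`: `x' = -L x` on every interval on which the continuous-time subsystem is active
(up to and including its right end point), and `x (s + 1) = (I - h L) x s` for every discrete-time
step. The values of `x` outside `S.timeDomain` are irrelevant. -/
structure IsTrajectory {n : ℕ} (L : Matrix (Fin n) (Fin n) ℝ) (h : ℝ) (S : SwitchingLaw)
    (x : ℝ → Fin n → ℝ) : Prop where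
  continuous_time : ∀ a b : ℝ, a < b → Set.Ico a b ⊆ S.ctTimes → ∀ t ∈ Set.Icc a b,
    HasDerivWithinAt x (-(L.mulVec (x t))) (Set.Icc a b) t
  discrete_time : ∀ s ∈ S.steps, x (s + 1) = (1 - h • L).mulVec (x s)

/-- Started at `x₀`, the switched system under the law `S` has a trajectory, and along every
trajectory all components tend to the same value `c`. -/
def ConvergesToConsensus {n : ℕ} (L : Matrix (Fin n) (Fin n) ℝ) (h : ℝ) (S : SwitchingLaw)
    (x₀ : Fin n → ℝ) (c : ℝ) : Prop :=
  (∃ x : ℝ → Fin n → ℝ, IsTrajectory L h S x ∧ x 0 = x₀) ∧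
    ∀ x : ℝ → Fin n → ℝ, IsTrajectory L h S x → x 0 = x₀ →
      ∀ i, Tendsto (fun t => ‖x t i - c‖) S.toInfinity (𝓝 0)

/-- The switched system reaches consensus under the law `S`. -/
def ReachesConsensus {n : ℕ} (L : Matrix (Fin n) (Fin n) ℝ) (h : ℝ) (S : SwitchingLaw) : Prop :=
  ∀ x₀ : Fin n → ℝ, ∃ c : ℝ, ConvergesToConsensus L h S x₀ c

/-! Put `A = I - hL` and `J = 1wᵀ`, where `wᵀL = 0` and `wᵀ1 = 1`. Both modes are governed by powers
of `A`: a discrete step is `A` itself, and `exp(-τL) = exp(b(A - I)) = e^{-b} ∑ bᵐ Aᵐ / m!` with `b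
= τ/h` is a Poisson average of its powers. All factors commute, so at time `t = k + τ` the state is
`exp(-τL) Aᵏ x(0)`, whatever the order of the modes.

It remains to bound `Aᵐ - J` by `C ρᵐ` with `ρ < 1` (`exists_norm_pow_sub_le`). The spanning tree
makes `ker L` the constants, by a maximum principle; subtracting `J` replaces the eigenvalue 1 of
`A` by 0, and the bound on `h` puts the other eigenvalues `1 - hμ` inside the unit disc. Averaging
(`norm_exp_mul_pow_sub_le`) gives the error factor `C ρᵏ e^{-(1-ρ)τ/h}`, which is exponentially
small in `t` for every switching law. -/

namespace WeightedDigraph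

/-! ### Maximum principle and null vectors of the Laplacian -/

variable {n : ℕ}

theorem laplacian_mulVec_apply (G : WeightedDigraph n) (y : Fin n → ℝ) (i : Fin n) :
    G.laplacian.mulVec y i = ∑ j, G.weight i j * (y i - y j) := by
  simp only [laplacian, Matrix.sub_mulVec, Pi.sub_apply, Matrix.mulVec_diagonal]
  simp only [Matrix.mulVec, dotProduct, mul_sub, Finset.sum_sub_distrib, Finset.sum_mul]

theorem laplacian_mulVec_one (G : WeightedDigraph n) : G.laplacian.mulVec 1 = 0 := by
  ext i
  simp [laplacian_mulVec_apply]

/-- A property that passes from the head of every edge to its tail and holds somewhere holds at the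
root of a spanning tree. -/
theorem HasDirectedSpanningTree.exists_root {G : WeightedDigraph n}
    (hG : G.HasDirectedSpanningTree) :
    ∃ r : Fin n, ∀ P : Fin n → Prop, (∀ u v, G.Edge u v → P v → P u) → ∀ v, P v → P r := by
  obtain ⟨T, hT, r, hr⟩ := hG
  refine ⟨r, fun P hP v hv => ?_⟩
  by_cases hvr : v = r
  · exact hvr ▸ hv
  obtain ⟨p, ⟨hhead, hlast, hchain, -⟩, -⟩ := hr v hvr
  refine hchain.backwards_induction P p (fun x y hxy => hP x y (hT x y hxy)) (fun hne => ?_) r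
    (List.mem_of_head? hhead)
  rw [List.getLast?_eq_getLast_of_ne_nil hne] at hlast
  rwa [Option.some.inj hlast]

/-- If the entries of `L y` are nonpositive at a place where `y` is maximal, then `y` is maximal at
all in-neighbours. -/
theorem eq_of_edge_of_isMax (G : WeightedDigraph n) {y : Fin n → ℝ} {i : Fin n}
    (hi : ∀ j, y j ≤ y i) (hL : G.laplacian.mulVec y i ≤ 0) {j : Fin n} (hj : G.Edge j i) :
    y j = y i := by
  rw [laplacian_mulVec_apply] at hL
  have hnn : ∀ k ∈ Finset.univ, 0 ≤ G.weight i k * (y i - y k) := fun k _ =>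
    mul_nonneg (G.weight_nonneg i k) (sub_nonneg.2 (hi k))
  have h0 := (Finset.sum_eq_zero_iff_of_nonneg hnn).1 (le_antisymm hL (Finset.sum_nonneg hnn)) j
    (Finset.mem_univ j)
  rcases mul_eq_zero.1 h0 with h | h
  · exact absurd h (ne_of_gt hj)
  · linarith

/-- The set of maximisers of `y` is closed under passing to in-neighbours, so it contains the root.
-/
theorem le_root_of_laplacian_mulVec_eq_zero (G : WeightedDigraph n) {y : Fin n → ℝ} {r : Fin n}
    (hr : ∀ P : Fin n → Prop, (∀ u v, G.Edge u v → P v → P u) → ∀ v, P v → P r)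
    (hy : G.laplacian.mulVec y = 0) (i : Fin n) : y i ≤ y r := by
  have : Nonempty (Fin n) := ⟨r⟩
  obtain ⟨m, hm⟩ := Finite.exists_max y
  refine hr (fun v => ∀ j, y j ≤ y v) (fun u v huv hv j => ?_) m hm i
  rw [G.eq_of_edge_of_isMax hv (le_of_eq (congrFun hy v)) huv]
  exact hv j

/-- The kernel of the Laplacian of a graph with a spanning tree consists of the constant vectors. -/
theorem HasDirectedSpanningTree.exists_const_of_mulVec_eq_zero {G : WeightedDigraph n}
    (hG : G.HasDirectedSpanningTree) {y : Fin n → ℝ} (hy : G.laplacian.mulVec y = 0) :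
    ∃ c : ℝ, ∀ i, y i = c := by
  obtain ⟨r, hr⟩ := hG.exists_root
  refine ⟨y r, fun i => le_antisymm (G.le_root_of_laplacian_mulVec_eq_zero hr hy i) ?_⟩
  have := G.le_root_of_laplacian_mulVec_eq_zero hr (y := -y) (by rw [Matrix.mulVec_neg, hy, neg_zero]) i
  simpa using this

theorem map_ofReal_mulVec_re (M : Matrix (Fin n) (Fin n) ℝ) (v : Fin n → ℂ) (i : Fin n) :
    ((M.map Complex.ofReal).mulVec v i).re = M.mulVec (fun j => (v j).re) i := by
  simp [Matrix.mulVec, dotProduct, Complex.re_sum]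

theorem map_ofReal_mulVec_im (M : Matrix (Fin n) (Fin n) ℝ) (v : Fin n → ℂ) (i : Fin n) :
    ((M.map Complex.ofReal).mulVec v i).im = M.mulVec (fun j => (v j).im) i := by
  simp [Matrix.mulVec, dotProduct, Complex.im_sum]

theorem HasDirectedSpanningTree.exists_const_of_complex_mulVec_eq_zero {G : WeightedDigraph n}
    (hG : G.HasDirectedSpanningTree) {v : Fin n → ℂ}
    (hv : (G.laplacian.map Complex.ofReal).mulVec v = 0) : ∃ c : ℂ, ∀ i, v i = c := by
  obtain ⟨a, ha⟩ := hG.exists_const_of_mulVec_eq_zero (y := fun j => (v j).re) (by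
    ext i; rw [← map_ofReal_mulVec_re, hv]; rfl)
  obtain ⟨b, hb⟩ := hG.exists_const_of_mulVec_eq_zero (y := fun j => (v j).im) (by
    ext i; rw [← map_ofReal_mulVec_im, hv]; rfl)
  exact ⟨⟨a, b⟩, fun i => Complex.ext (ha i) (hb i)⟩

/-- The constant vector `1` is not in the range of the Laplacian. -/
theorem laplacian_mulVec_ne_one [Nonempty (Fin n)] (G : WeightedDigraph n) (y : Fin n → ℝ) :
    G.laplacian.mulVec y ≠ 1 := by
  intro hy
  obtain ⟨m, hm⟩ := Finite.exists_min y
  have h1 := congrFun hy m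
  rw [laplacian_mulVec_apply, Pi.one_apply] at h1
  have : ∑ j, G.weight m j * (y m - y j) ≤ 0 := Finset.sum_nonpos fun j _ =>
    mul_nonpos_of_nonneg_of_nonpos (G.weight_nonneg m j) (sub_nonpos.2 (hm j))
  linarith

/-- As `1` is outside the range of `L`, some functional kills the range but not `1`; normalised, its
coordinates are `w`. -/
theorem exists_vecMul_laplacian_eq_zero [Nonempty (Fin n)] (G : WeightedDigraph n) :
    ∃ w : Fin n → ℝ, Matrix.vecMul w G.laplacian = 0 ∧ w ⬝ᵥ 1 = 1 := by
  have hnot : (1 : Fin n → ℝ) ∉ LinearMap.range (Matrix.toLin' G.laplacian) := by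
    rintro ⟨y, hy⟩
    exact G.laplacian_mulVec_ne_one y (by simpa using hy)
  obtain ⟨f, hf1, hf⟩ := Submodule.exists_le_ker_of_notMem hnot
  have hdot : ∀ x, (fun i => f (Pi.single i 1)) ⬝ᵥ x = f x := fun x => by
    conv_rhs => rw [pi_eq_sum_univ' x]
    simp [dotProduct, mul_comm]
  refine ⟨(f 1)⁻¹ • fun i => f (Pi.single i 1), ?_, ?_⟩
  · rw [Matrix.smul_vecMul]
    refine (congrArg _ (dotProduct_eq_zero _ fun x => ?_)).trans (smul_zero _)
    rw [← Matrix.dotProduct_mulVec, hdot]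
    exact hf ⟨x, by simp⟩
  · rw [smul_dotProduct, hdot, smul_eq_mul, inv_mul_cancel₀ hf1]

end WeightedDigraph

/-! ### Geometric convergence of the powers of `I - hL` -/

section

attribute [local instance] Matrix.linftyOpNormedRing Matrix.linftyOpNormedAlgebra

/-- The powers of an element of spectral radius less than one decay geometrically. -/
theorem exists_norm_pow_le_of_spectralRadius_lt_one {𝔸 : Type*} [NormedRing 𝔸] [NormedAlgebra ℂ 𝔸]
    [CompleteSpace 𝔸] {a : 𝔸} (ha : spectralRadius ℂ a < 1) :
    ∃ C ρ : ℝ, 0 ≤ C ∧ 0 < ρ ∧ ρ < 1 ∧ ∀ m : ℕ, ‖a ^ m‖ ≤ C * ρ ^ m := by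
  obtain ⟨q, hq, hq1⟩ := ENNReal.lt_iff_exists_nnreal_btwn.1 ha
  have hq0 : 0 < q := ENNReal.coe_pos.1 (lt_of_le_of_lt zero_le hq)
  have hev := (spectrum.pow_nnnorm_pow_one_div_tendsto_nhds_spectralRadius a).eventually_lt_const hq
  obtain ⟨N, hN⟩ := eventually_atTop.1 hev
  have hbig : ∀ m, N + 1 ≤ m → ‖a ^ m‖ ≤ (q : ℝ) ^ m := fun m hm => by
    have hm0 : m ≠ 0 := by omega
    have h1 := (hN m (by omega)).le
    have h2 := ENNReal.rpow_le_rpow h1 (Nat.cast_nonneg (α := ℝ) m)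
    rw [← ENNReal.rpow_mul, one_div, inv_mul_cancel₀ (by exact_mod_cast hm0), ENNReal.rpow_one,
      ENNReal.rpow_natCast] at h2
    exact_mod_cast h2
  have hqR : (0 : ℝ) < q := by exact_mod_cast hq0
  -- The summand 1 serves large `m`; the sum covers the finitely many exponents `m ≤ N`.
  refine ⟨1 + ∑ k ∈ Finset.range (N + 1), ‖a ^ k‖ / q ^ k, q, by positivity, hqR, by exact_mod_cast hq1,
    fun m => ?_⟩
  by_cases hm : N + 1 ≤ m
  · refine (hbig m hm).trans (le_mul_of_one_le_left (by positivity) ?_)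
    exact le_add_of_nonneg_right (by positivity)
  · rw [← div_le_iff₀ (by positivity)]
    have := Finset.single_le_sum (f := fun k => ‖a ^ k‖ / (q : ℝ) ^ k) (fun k _ => by positivity)
      (Finset.mem_range.2 (not_le.1 hm))
    linarith

theorem Matrix.linfty_opNorm_map_ofReal {n : ℕ} (M : Matrix (Fin n) (Fin n) ℝ) :
    ‖M.map Complex.ofReal‖ = ‖M‖ := by
  simp [Matrix.linfty_opNorm_def]

/-- Expand `|1 - hμ|² = 1 - 2h Re μ + h²|μ|²`. -/
theorem norm_one_sub_mul_lt_one {h : ℝ} (h_pos : 0 < h) {μ : ℂ} (hμ : μ ≠ 0)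
    (h_lt : h < 2 * μ.re / ‖μ‖ ^ 2) : ‖1 - h * μ‖ < 1 := by
  have hn : 0 < ‖μ‖ ^ 2 := by positivity
  rw [lt_div_iff₀ hn, Complex.sq_norm, Complex.normSq_apply] at h_lt
  rw [← sq_lt_one_iff₀ (norm_nonneg _), Complex.sq_norm, Complex.normSq_apply]
  simp
  nlinarith

namespace WeightedDigraph

variable {n : ℕ}

/-- The powers of `I - h L` converge geometrically to `1 wᵀ`. -/
theorem HasDirectedSpanningTree.exists_norm_pow_sub_le {G : WeightedDigraph n}
    (hG : G.HasDirectedSpanningTree) {h : ℝ} (h_pos : 0 < h)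
    (h_lt : ∀ μ : ℂ, G.IsLaplacianEigenvalue μ → μ ≠ 0 → h < 2 * μ.re / ‖μ‖ ^ 2)
    {w : Fin n → ℝ} (hw : Matrix.vecMul w G.laplacian = 0) (hw1 : w ⬝ᵥ 1 = 1) :
    ∃ C ρ : ℝ, 0 ≤ C ∧ 0 < ρ ∧ ρ < 1 ∧
      ∀ m : ℕ, ‖(1 - h • G.laplacian) ^ m - Matrix.vecMulVec 1 w‖ ≤ C * ρ ^ m := by
  have : Nonempty (Fin n) := ⟨hG.exists_root.choose⟩
  set A := 1 - h • G.laplacian with hA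
  set J := Matrix.vecMulVec 1 w with hJ
  have hJJ : J * J = J := by
    rw [hJ, Matrix.vecMulVec_mul_vecMulVec, hw1]; simp
  have hAJ : A * J = J := by
    rw [hA, hJ, sub_mul, one_mul, smul_mul_assoc, Matrix.mul_vecMulVec, laplacian_mulVec_one]
    simp
  have hJA : J * A = J := by
    rw [hA, hJ, mul_sub, mul_one, mul_smul_comm, Matrix.vecMulVec_mul, hw]
    simp
  -- Only positive exponents: at exponent 0 the two sides are `I - J` and `I`.
  have hpow : ∀ m : ℕ, A ^ (m + 1) - J = (A - J) ^ (m + 1) := by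
    intro m
    induction m with
    | zero => simp
    | succ m ih =>
      rw [pow_succ (A - J), ← ih, sub_mul, mul_sub (A ^ (m + 1)), mul_sub J, ← pow_succ, hJA, hJJ,
        sub_self, sub_zero]
      congr 1
      clear ih
      induction m with
      | zero => simpa using hAJ.symm
      | succ m ih => rw [pow_succ, mul_assoc, hAJ]; exact ih
  have hrad : spectralRadius ℂ ((A - J).map Complex.ofReal) < 1 := by
    have key : ∀ ν ∈ spectrum ℂ ((A - J).map Complex.ofReal), ‖ν‖₊ < 1 := by
      intro ν hν
      by_cases hν0 : ν = 0
      · simp [hν0]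
      rw [← Matrix.spectrum_toLin', ← Module.End.hasEigenvalue_iff_mem_spectrum] at hν
      obtain ⟨v, hv⟩ := hν.exists_hasEigenvector
      have hv0 : v ≠ 0 := hv.2
      have hve : ((A - J).map Complex.ofReal).mulVec v = ν • v := by
        simpa using hv.apply_eq_smul
      have hmul : ∀ M N : Matrix (Fin n) (Fin n) ℝ, (M * N).map Complex.ofReal =
        M.map Complex.ofReal * N.map Complex.ofReal := fun M N =>
          Matrix.map_mul (f := Complex.ofRealHom)
      -- Since `J(A - J) = 0`, applying `J` to the eigenvalue equation gives `ν Jv = 0`.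
      have hJv : (J.map Complex.ofReal).mulVec v = 0 := by
        have h1 : (J.map Complex.ofReal).mulVec (((A - J).map Complex.ofReal).mulVec v) = 0 := by
          rw [Matrix.mulVec_mulVec, ← hmul, mul_sub, hJA, hJJ, sub_self]
          ext i; simp [Matrix.mulVec, dotProduct]
        rw [hve, Matrix.mulVec_smul] at h1
        exact (smul_eq_zero.1 h1).resolve_left hν0
      have hdecomp : (A - J).map Complex.ofReal =
          1 - (h : ℂ) • G.laplacian.map Complex.ofReal - J.map Complex.ofReal := by
        ext i j
        simp [hA, Matrix.one_apply, apply_ite Complex.ofReal]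
      rw [hdecomp, Matrix.sub_mulVec, hJv, sub_zero, Matrix.sub_mulVec, Matrix.one_mulVec,
        Matrix.smul_mulVec] at hve
      have hh : (h : ℂ) ≠ 0 := by exact_mod_cast h_pos.ne'
      have hLv : (G.laplacian.map Complex.ofReal).mulVec v = ((1 - ν) / h) • v := by
        have : (h : ℂ) • (G.laplacian.map Complex.ofReal).mulVec v = (1 - ν) • v := by
          rw [sub_smul, one_smul, ← hve]; abel
        rw [div_eq_inv_mul, mul_smul, ← this, smul_smul, inv_mul_cancel₀ hh, one_smul]
      -- In the zero case `v` is constant, and a constant vector is fixed by `J`, so `Jv = 0` forces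
      -- `v = 0`.
      by_cases hμ : (1 - ν) / h = 0
      · exfalso
        rw [hμ, zero_smul] at hLv
        obtain ⟨c, hc⟩ := hG.exists_const_of_complex_mulVec_eq_zero hLv
        have i : Fin n := Classical.arbitrary _
        have h2 := congrFun hJv i
        have hw1' : ∑ j, (w j : ℂ) = 1 := by
          rw [← Complex.ofReal_sum, ← Complex.ofReal_one, ← hw1]; simp [dotProduct]
        simp only [hJ, Matrix.mulVec, dotProduct, hc, Matrix.map_apply, Matrix.vecMulVec_apply,
          Pi.one_apply, one_mul, ← Finset.sum_mul, hw1', Pi.zero_apply] at h2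
        exact hv0 (funext fun j => by rw [hc j, h2]; rfl)
      · have hev : G.IsLaplacianEigenvalue ((1 - ν) / h) :=
          Module.End.hasEigenvalue_of_hasEigenvector (x := v)
            ⟨Module.End.mem_eigenspace_iff.2 (by simpa using hLv), hv0⟩
        have := norm_one_sub_mul_lt_one h_pos hμ (h_lt _ hev hμ)
        rw [mul_div_cancel₀ _ hh, sub_sub_cancel] at this
        exact_mod_cast this
    have : Nontrivial (Matrix (Fin n) (Fin n) ℂ) := inferInstance
    exact_mod_cast spectrum.spectralRadius_lt_of_forall_lt ((A - J).map Complex.ofReal) key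
  obtain ⟨C, ρ, hC, hρ0, hρ1, hb⟩ := exists_norm_pow_le_of_spectralRadius_lt_one hrad
  -- The term `‖1 - J‖` takes care of `m = 0`.
  refine ⟨C + ‖1 - J‖, ρ, by positivity, hρ0, hρ1, fun m => ?_⟩
  cases m with
  | zero => simpa using hC
  | succ m =>
    have hmapPow : ((A - J) ^ (m + 1)).map Complex.ofReal =
        ((A - J).map Complex.ofReal) ^ (m + 1) :=
      map_pow (Complex.ofRealHom.mapMatrix (m := Fin n)) _ _
    rw [hpow, ← Matrix.linfty_opNorm_map_ofReal, hmapPow]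
    refine (hb (m + 1)).trans (mul_le_mul_of_nonneg_right ?_ (by positivity))
    exact le_add_of_nonneg_right (norm_nonneg _)

/-- The left null vector of the Laplacian is unique up to scaling. -/
theorem HasDirectedSpanningTree.eq_of_vecMul_laplacian_eq_zero {G : WeightedDigraph n}
    (hG : G.HasDirectedSpanningTree) {h : ℝ} (h_pos : 0 < h)
    (h_lt : ∀ μ : ℂ, G.IsLaplacianEigenvalue μ → μ ≠ 0 → h < 2 * μ.re / ‖μ‖ ^ 2)
    {w w' : Fin n → ℝ} (hw : Matrix.vecMul w G.laplacian = 0) (hw1 : w ⬝ᵥ 1 = 1)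
    (hw' : Matrix.vecMul w' G.laplacian = 0) (hw1' : w' ⬝ᵥ 1 = 1) : w = w' := by
  have key : ∀ u : Fin n → ℝ, Matrix.vecMul u G.laplacian = 0 → u ⬝ᵥ 1 = 1 →
      Tendsto (fun m => (1 - h • G.laplacian) ^ m) atTop (𝓝 (Matrix.vecMulVec 1 u)) := by
    intro u hu hu1
    obtain ⟨C, ρ, -, hρ0, hρ1, hb⟩ := hG.exists_norm_pow_sub_le h_pos h_lt hu hu1
    refine tendsto_iff_norm_sub_tendsto_zero.2 (squeeze_zero (fun _ => norm_nonneg _) hb ?_)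
    simpa using (tendsto_pow_atTop_nhds_zero_of_lt_one hρ0.le hρ1).const_mul C
  have heq := tendsto_nhds_unique (key w hw hw1) (key w' hw' hw1')
  -- Every row of `1wᵀ` is `wᵀ`; the root merely supplies a row index.
  obtain ⟨r, -⟩ := hG.exists_root
  ext j
  simpa [Matrix.vecMulVec_apply] using congrFun (congrFun heq r) j

end WeightedDigraph

end

/-! ### Poisson averages of powers -/

section

open NormedSpace

/-- If the powers of `a` converge geometrically to `j`, then so do the Poisson averages of these
powers. -/
theorem norm_exp_mul_pow_sub_le {𝔸 : Type*} [NormedRing 𝔸] [NormedAlgebra ℝ 𝔸] [CompleteSpace 𝔸]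
    {a j : 𝔸} {C ρ : ℝ} (ha : ∀ m : ℕ, ‖a ^ m - j‖ ≤ C * ρ ^ m) {b : ℝ} (hb : 0 ≤ b) (k : ℕ) :
    ‖exp (b • (a - 1)) * a ^ k - j‖ ≤ C * ρ ^ k * Real.exp (-((1 - ρ) * b)) := by
  let _ : NormedAlgebra ℚ 𝔸 := NormedAlgebra.restrictScalars ℚ ℝ 𝔸
  have hsplit : exp (b • (a - 1)) = Real.exp (-b) • exp (b • a) := by
    have h1 : b • (a - 1) = algebraMap ℝ 𝔸 (-b) + b • a := by
      rw [Algebra.algebraMap_eq_smul_one, smul_sub, neg_smul]; abel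
    rw [h1, exp_add_of_commute (Algebra.commutes _ _), ← algebraMap_exp_comm (-b),
      ← Real.exp_eq_exp_ℝ, Algebra.algebraMap_eq_smul_one, smul_mul_assoc, one_mul]
  have hsum : HasSum (fun m : ℕ => ((m.factorial : ℝ)⁻¹ * b ^ m) • (a ^ (m + k) - j))
      (exp (b • a) * a ^ k - Real.exp b • j) := by
    have h1 := (exp_series_hasSum_exp' (𝕂 := ℝ) (b • a)).mul_right (a ^ k)
    have h2 := (exp_series_hasSum_exp' (𝕂 := ℝ) b).smul_const j
    rw [← Real.exp_eq_exp_ℝ] at h2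
    refine (h1.sub h2).congr_fun fun m => ?_
    rw [smul_sub, smul_pow, smul_smul, smul_mul_assoc, ← pow_add, smul_eq_mul]
  have hreal : HasSum (fun m : ℕ => (m.factorial : ℝ)⁻¹ * (ρ * b) ^ m * (C * ρ ^ k))
      (Real.exp (ρ * b) * (C * ρ ^ k)) := by
    have h1 := (exp_series_hasSum_exp' (𝕂 := ℝ) (ρ * b)).mul_right (C * ρ ^ k)
    rwa [← Real.exp_eq_exp_ℝ] at h1
  -- The termwise bounds sum to `C ρᵏ e^{ρb}`; the prefactor `e^{-b}` then leaves `e^{-(1-ρ)b}`.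
  have hnorm := hsum.norm_le_of_bounded hreal fun m => by
    rw [norm_smul, Real.norm_of_nonneg (by positivity)]
    refine (mul_le_mul_of_nonneg_left (ha (m + k)) (by positivity)).trans (le_of_eq ?_)
    rw [mul_pow, pow_add]; ring
  have heq : exp (b • (a - 1)) * a ^ k - j =
      Real.exp (-b) • (exp (b • a) * a ^ k - Real.exp b • j) := by
    rw [hsplit, smul_sub, smul_smul, ← Real.exp_add, neg_add_cancel, Real.exp_zero, one_smul,
      smul_mul_assoc]
  rw [heq, norm_smul, Real.norm_of_nonneg (Real.exp_pos _).le]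
  refine (mul_le_mul_of_nonneg_left hnorm (Real.exp_pos _).le).trans (le_of_eq ?_)
  rw [← mul_assoc, ← Real.exp_add, mul_comm]
  congr 2
  ring

end

/-! ### The continuous-time flow -/

section

attribute [local instance] Matrix.linftyOpNormedRing Matrix.linftyOpNormedAlgebra

variable {n : ℕ}

theorem hasDerivAt_exp_neg_smul_mulVec (L : Matrix (Fin n) (Fin n) ℝ) (v : Fin n → ℝ) (c t : ℝ) :
    HasDerivAt (fun u => (NormedSpace.exp (-(u - c) • L)).mulVec v)
      (-(L.mulVec ((NormedSpace.exp (-(t - c) • L)).mulVec v))) t := by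
  have h1 := (hasDerivAt_exp_smul_const' (𝕂 := ℝ) (-L) (t - c)).comp_sub_const t c
  have h2 := (((Matrix.mulVecBilin ℝ ℝ).flip v).toContinuousLinearMap.hasFDerivAt
    (x := NormedSpace.exp ((t - c) • -L))).comp_hasDerivAt t h1
  have hfun : (fun u => (NormedSpace.exp (-(u - c) • L)).mulVec v) =
      ((Matrix.mulVecBilin ℝ ℝ).flip v).toContinuousLinearMap ∘
        fun u => NormedSpace.exp ((u - c) • -L) := by
    ext1 u
    rw [neg_smul, ← smul_neg]
    rfl
  rw [hfun]
  refine h2.congr_deriv ?_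
  rw [Matrix.mulVec_mulVec, ← Matrix.neg_mulVec, ← neg_mul, neg_smul, ← smul_neg]
  rfl

theorem eq_exp_mulVec_of_hasDerivWithinAt {L : Matrix (Fin n) (Fin n) ℝ} {x : ℝ → Fin n → ℝ}
    {a b : ℝ} (hab : a ≤ b)
    (hx : ∀ t ∈ Set.Icc a b, HasDerivWithinAt x (-(L.mulVec (x t))) (Set.Icc a b) t) :
    x b = (NormedSpace.exp (-(b - a) • L)).mulVec (x a) := by
  have hlip : ∀ _ : ℝ, LipschitzWith ‖(-L.mulVecLin).toContinuousLinearMap‖₊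
      fun v : Fin n → ℝ => -(L.mulVec v) := fun _ =>
    (-L.mulVecLin).toContinuousLinearMap.lipschitz
  refine ODE_solution_unique (v := fun _ v => -(L.mulVec v)) (f := x)
    (g := fun t => (NormedSpace.exp (-(t - a) • L)).mulVec (x a)) hlip
    (fun t ht => (hx t ht).continuousWithinAt)
    (fun t ht => (hx t (Set.Ico_subset_Icc_self ht)).mono_of_mem_nhdsWithin
      (Icc_mem_nhdsGE_of_mem ht))
    (fun t _ => (hasDerivAt_exp_neg_smul_mulVec L (x a) a t).continuousAt.continuousWithinAt)
    (fun t _ => (hasDerivAt_exp_neg_smul_mulVec L (x a) a t).hasDerivWithinAt) ?_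
    (Set.right_mem_Icc.2 hab)
  simp

end

/-! ### Counting completed discrete-time steps -/

namespace SwitchingLaw

variable (S : SwitchingLaw)

/-- The instants at which the discrete-time steps completed by time `t` start. -/
def completedSteps (t : ℝ) : Set ℝ := {s | s ∈ S.steps ∧ s + 1 ≤ t}

/-- Steps a unit apart have distinct floors, all between 0 and `⌊t⌋`. -/
theorem completedSteps_finite (t : ℝ) : (S.completedSteps t).Finite := by
  refine Set.Finite.of_finite_image (f := fun s : ℝ => ⌊s⌋)
    ((Set.finite_Icc (0 : ℤ) ⌊t⌋).subset ?_) ?_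
  · rintro _ ⟨s, hs, rfl⟩
    exact ⟨Int.floor_nonneg.2 (S.steps_nonneg s hs.1), Int.floor_mono (by linarith [hs.2])⟩
  · have key : ∀ s ∈ S.steps, ∀ s' ∈ S.steps, s < s' → ⌊s⌋ ≠ ⌊s'⌋ := fun s hs s' hs' hlt heq => by
      have := Int.floor_mono (S.steps_separated s hs s' hs' hlt)
      rw [Int.floor_add_one] at this
      omega
    intro s hs s' hs' heq
    rcases lt_trichotomy s s' with h | h | h
    · exact absurd heq (key s hs.1 s' hs'.1 h)
    · exact h
    · exact absurd heq.symm (key s' hs'.1 s hs.1 h)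

theorem completedSteps_zero : S.completedSteps 0 = ∅ := by
  ext s
  simp only [completedSteps, Set.mem_ofPred_eq, Set.mem_empty_iff_false, iff_false, not_and, not_le]
  intro hs
  linarith [S.steps_nonneg s hs]

theorem completedSteps_add_one {s : ℝ} (hs : s ∈ S.steps) :
    S.completedSteps (s + 1) = insert s (S.completedSteps s) := by
  ext s'
  simp only [completedSteps, Set.mem_ofPred_eq, Set.mem_insert_iff, add_le_add_iff_right]
  constructor
  · rintro ⟨h1, h2⟩
    rcases h2.eq_or_lt with h | h
    · exact Or.inl h
    · exact Or.inr ⟨h1, S.steps_separated s' h1 s hs h⟩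
  · rintro (rfl | ⟨h1, h2⟩)
    · exact ⟨hs, le_rfl⟩
    · exact ⟨h1, by linarith⟩

/-- A step completed in `(a, t]` would make the discrete mode active at `a` or at its own start in
`(a, b)`. -/
theorem completedSteps_eq_of_Ico_subset {a b t : ℝ} (hab : Set.Ico a b ⊆ S.ctTimes)
    (ht : t ∈ Set.Icc a b) : S.completedSteps t = S.completedSteps a := by
  ext s
  refine and_congr_right fun hs => ⟨fun h => ?_, fun h => h.trans ht.1⟩
  by_contra hlt
  rw [not_le] at hlt
  rcases le_or_gt s a with hsa | hsa
  · exact (hab ⟨le_rfl, by linarith [ht.2]⟩).2 s hs ⟨hsa, hlt⟩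
  · exact (hab ⟨hsa.le, by linarith [ht.2]⟩).2 s hs ⟨le_rfl, by linarith⟩

theorem mem_timeDomain_of_mem_steps {s : ℝ} (hs : s ∈ S.steps) : s ∈ S.timeDomain := by
  refine ⟨S.steps_nonneg s hs, fun s' hs' h => ?_⟩
  linarith [S.steps_separated s' hs' s hs h.1, h.2]

/-- Between the last completed step (or time `0`) and an instant of the time domain, the
continuous-time subsystem is active. -/
theorem Ico_subset_ctTimes {t a : ℝ} (ht : t ∈ S.timeDomain) (ha : 0 ≤ a)
    (hlast : ∀ s ∈ S.completedSteps t, s + 1 ≤ a) : Set.Ico a t ⊆ S.ctTimes := by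
  refine fun u hu => ⟨ha.trans hu.1, fun s hs hsu => ?_⟩
  rcases le_or_gt (s + 1) t with h | h
  · linarith [hlast s ⟨hs, h⟩, hu.1, hsu.2]
  · exact ht.2 s hs ⟨by linarith [hsu.1, hu.2], h⟩

end SwitchingLaw

/-! ### Trajectories and their convergence -/

section

attribute [local instance] Matrix.linftyOpNormedRing Matrix.linftyOpNormedAlgebra

variable {n : ℕ} {L : Matrix (Fin n) (Fin n) ℝ} {h : ℝ} {S : SwitchingLaw}

theorem commute_exp_smul_one_sub_smul (L : Matrix (Fin n) (Fin n) ℝ) (h τ : ℝ) :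
    Commute (NormedSpace.exp (τ • L)) (1 - h • L) :=
  ((Commute.one_right _).sub_right (((Commute.refl L).smul_left τ).smul_right h)).exp_left

/-- The switched system has a trajectory from every initial state. -/
theorem exists_isTrajectory (L : Matrix (Fin n) (Fin n) ℝ) (h : ℝ) (S : SwitchingLaw)
    (x₀ : Fin n → ℝ) : ∃ x : ℝ → Fin n → ℝ, IsTrajectory L h S x ∧ x 0 = x₀ := by
  -- With `N` steps completed by a time `t` of the time domain, the continuous mode has run for `t -
  -- N`.
  refine ⟨fun t => (NormedSpace.exp (-(t - (S.completedSteps t).ncard) • L)).mulVec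
    (((1 - h • L) ^ (S.completedSteps t).ncard).mulVec x₀), ⟨fun a b _ hab t ht => ?_,
    fun s hs => ?_⟩, ?_⟩
  · have heq := fun u hu => S.completedSteps_eq_of_Ico_subset (t := u) hab hu
    rw [heq t ht]
    refine (hasDerivAt_exp_neg_smul_mulVec L _ _ t).hasDerivWithinAt.congr (fun u hu => ?_) ?_
    · rw [heq u hu]
    · rw [heq t ht]
  · have hcard : (S.completedSteps (s + 1)).ncard = (S.completedSteps s).ncard + 1 := by
      rw [S.completedSteps_add_one hs]
      exact Set.ncard_insert_of_notMem (fun hmem => by linarith [hmem.2])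
        (S.completedSteps_finite s)
    simp only [hcard, Matrix.mulVec_mulVec, Nat.cast_add, Nat.cast_one, add_sub_add_right_eq_sub]
    rw [pow_succ', ← mul_assoc, (commute_exp_smul_one_sub_smul L h _).eq, mul_assoc]
  · simp [S.completedSteps_zero]

/-- The state at time `t` results from `k` discrete-time steps and `τ` units of continuous
evolution, where `k + τ = t`. -/
theorem IsTrajectory.exists_eq {x : ℝ → Fin n → ℝ} (hx : IsTrajectory L h S x) {t : ℝ}
    (ht : t ∈ S.timeDomain) : ∃ (k : ℕ) (τ : ℝ), 0 ≤ τ ∧ k + τ = t ∧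
      x t = (NormedSpace.exp (-τ • L) * (1 - h • L) ^ k).mulVec (x 0) := by
  -- Induction on a bound for `t`: the last completed step starts at least one unit before `t`.
  obtain ⟨N, hN⟩ := exists_nat_gt t
  induction N generalizing t with
  | zero => exact absurd ht.1 (by simpa using hN)
  | succ N ih =>
    have hflow : ∀ a, 0 ≤ a → a ≤ t → (∀ s ∈ S.completedSteps t, s + 1 ≤ a) →
        x t = (NormedSpace.exp (-(t - a) • L)).mulVec (x a) := fun a ha hat hlast => by
      rcases hat.eq_or_lt with rfl | hlt
      · simp
      · exact eq_exp_mulVec_of_hasDerivWithinAt hat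
          (hx.continuous_time a t hlt (S.Ico_subset_ctTimes ht ha hlast))
    rcases (S.completedSteps t).eq_empty_or_nonempty with hempty | hne
    · refine ⟨0, t, ht.1, by simp, ?_⟩
      rw [hflow 0 le_rfl ht.1 (by simp [hempty])]
      simp
    · obtain ⟨s, hs, hmax⟩ := Set.exists_max_image _ id (S.completedSteps_finite t) hne
      have hs0 := S.steps_nonneg s hs.1
      obtain ⟨k, τ, hτ, hk, heq⟩ := ih (S.mem_timeDomain_of_mem_steps hs.1) (by
        have := hs.2; push_cast at hN; linarith)
      refine ⟨k + 1, τ + (t - (s + 1)), by linarith [hs.2], by push_cast; linarith, ?_⟩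
      rw [hflow (s + 1) (by linarith) hs.2 fun s' hs' => by simpa using hmax s' hs',
        hx.discrete_time s hs.1, heq, Matrix.mulVec_mulVec, Matrix.mulVec_mulVec, neg_add, add_smul,
        Matrix.exp_add_of_commute _ _ (((Commute.refl L).smul_left _).smul_right _), pow_succ']
      congr 1
      rw [mul_assoc, ← mul_assoc (1 - h • L), ← (commute_exp_smul_one_sub_smul L h (-τ)).eq,
        (((Commute.refl L).smul_left (-τ)).smul_right (-(t - (s + 1)))).exp.eq]
      simp only [mul_assoc]

/-- If the powers of `I - h L` converge geometrically to `1 wᵀ`, then the switched system converges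
to `1 wᵀ x₀` under every switching law. -/
theorem convergesToConsensus_of_norm_pow_sub_le (h_pos : 0 < h) {w : Fin n → ℝ} {C ρ : ℝ}
    (hC : 0 ≤ C) (hρ0 : 0 < ρ) (hρ1 : ρ < 1)
    (hb : ∀ m : ℕ, ‖(1 - h • L) ^ m - Matrix.vecMulVec 1 w‖ ≤ C * ρ ^ m)
    (S : SwitchingLaw) (x₀ : Fin n → ℝ) : ConvergesToConsensus L h S x₀ (w ⬝ᵥ x₀) := by
  refine ⟨exists_isTrajectory L h S x₀, ?_⟩
  rintro x hx rfl i
  obtain ⟨c, hc, hρc, hhc⟩ : ∃ c : ℝ, 0 < c ∧ ρ ≤ Real.exp (-c) ∧ c ≤ (1 - ρ) / h := by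
    -- A common decay rate: `-log ρ` per discrete step, which lasts one unit, and `(1 - ρ)/h` per
    -- unit of continuous time.
    refine ⟨min (-Real.log ρ) ((1 - ρ) / h), lt_min (neg_pos.2 (Real.log_neg hρ0 hρ1))
      (div_pos (sub_pos.2 hρ1) h_pos), ?_, min_le_right _ _⟩
    rw [← Real.log_le_iff_le_exp hρ0]
    linarith [min_le_left (-Real.log ρ) ((1 - ρ) / h)]
  have hbound : ∀ t ∈ S.timeDomain,
      ‖x t i - w ⬝ᵥ x 0‖ ≤ C * Real.exp (-(c * t)) * ‖x 0‖ := by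
    intro t ht
    obtain ⟨k, τ, hτ, hk, heq⟩ := hx.exists_eq ht
    have h1 := norm_exp_mul_pow_sub_le hb (div_nonneg hτ h_pos.le) k
    have h2 : (τ / h) • ((1 - h • L) - 1) = -τ • L := by
      rw [sub_sub_cancel_left, smul_neg, smul_smul, div_mul_cancel₀ _ h_pos.ne', neg_smul]
    rw [h2] at h1
    have h3 : ρ ^ k * Real.exp (-((1 - ρ) * (τ / h))) ≤ Real.exp (-(c * t)) := by
      have h4 : -(c * t) = k * (-c) + -(c * τ) := by rw [← hk]; ring
      rw [h4, Real.exp_add, Real.exp_nat_mul]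
      refine mul_le_mul (pow_le_pow_left₀ hρ0.le hρc k) (Real.exp_le_exp.2 ?_)
        (Real.exp_pos _).le (by positivity)
      have := mul_le_mul_of_nonneg_right hhc hτ
      rw [neg_le_neg_iff]
      refine this.trans (le_of_eq ?_)
      ring
    have h5 : x t i - w ⬝ᵥ x 0 =
        ((NormedSpace.exp (-τ • L) * (1 - h • L) ^ k - Matrix.vecMulVec 1 w).mulVec (x 0)) i := by
      rw [Matrix.sub_mulVec, ← heq, Matrix.vecMulVec_mulVec]
      simp
    rw [h5]
    refine (norm_le_pi_norm _ i).trans ((Matrix.linfty_opNorm_mulVec _ _).trans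
      (mul_le_mul_of_nonneg_right (h1.trans ?_) (norm_nonneg _)))
    rw [mul_assoc]
    exact mul_le_mul_of_nonneg_left h3 hC
  have hlim : Tendsto (fun t => C * Real.exp (-(c * t)) * ‖x 0‖) S.toInfinity (𝓝 0) := by
    have h1 : Tendsto (fun t => C * Real.exp (-(c * t)) * ‖x 0‖) atTop (𝓝 (C * 0 * ‖x 0‖)) :=
      ((Real.tendsto_exp_neg_atTop_nhds_zero.comp
        (tendsto_id.const_mul_atTop hc)).const_mul C).mul_const _
    rw [mul_zero, zero_mul] at h1
    exact h1.mono_left inf_le_left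
  refine squeeze_zero' (Eventually.of_forall fun _ => norm_nonneg _) ?_ hlim
  exact (eventually_principal.2 hbound).filter_mono inf_le_right

end

theorem theorem2 {n : ℕ} (G : WeightedDigraph n) (hG : G.HasDirectedSpanningTree)
    (h : ℝ) (h_pos : 0 < h)
    (h_lt : ∀ μ : ℂ, G.IsLaplacianEigenvalue μ → μ ≠ 0 → h < 2 * μ.re / ‖μ‖ ^ 2) :
    (∀ S : SwitchingLaw, ReachesConsensus G.laplacian h S) ∧
      (∃! w : Fin n → ℝ, Matrix.vecMul w G.laplacian = 0 ∧ w ⬝ᵥ 1 = 1) ∧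
      ∀ w : Fin n → ℝ, Matrix.vecMul w G.laplacian = 0 → w ⬝ᵥ 1 = 1 →
        ∀ (S : SwitchingLaw) (x₀ : Fin n → ℝ),
          ConvergesToConsensus G.laplacian h S x₀ (w ⬝ᵥ x₀) := by
  have : Nonempty (Fin n) := ⟨hG.exists_root.choose⟩
  have hconv : ∀ w : Fin n → ℝ, Matrix.vecMul w G.laplacian = 0 → w ⬝ᵥ 1 = 1 →
      ∀ (S : SwitchingLaw) (x₀ : Fin n → ℝ),
        ConvergesToConsensus G.laplacian h S x₀ (w ⬝ᵥ x₀) := by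
    intro w hw hw1
    obtain ⟨C, ρ, hC, hρ0, hρ1, hb⟩ := hG.exists_norm_pow_sub_le h_pos h_lt hw hw1
    exact convergesToConsensus_of_norm_pow_sub_le h_pos hC hρ0 hρ1 hb
  obtain ⟨w, hw, hw1⟩ := G.exists_vecMul_laplacian_eq_zero
  exact ⟨fun S x₀ => ⟨w ⬝ᵥ x₀, hconv w hw hw1 S x₀⟩,
    ⟨w, ⟨hw, hw1⟩, fun w' hw' =>
      hG.eq_of_vecMul_laplacian_eq_zero h_pos h_lt hw'.1 hw'.2 hw hw1⟩, hconv⟩
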